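/- Let $N_n\to\infty$ be a sequence of dimensions and, for each $n$, let $F=F^{(n)}$ and $\Psi=\Psi^{(n)}$ be real (deterministic) $N_n\times N_n$ matrices such that every row of $F$ has Euclidean norm $1$, every column of $\Psi$ has Euclidean norm $1$, there are constants $c_1,c_2>0$ independent of $n$ with $$\frac{c_1}{\sqrt{N_n}}\le |F_{ik}|\le \frac{c_2}{\sqrt{N_n}}\qquad\text{for all } i,k \text{ and all sufficiently large } n,$$ and $\max_{k,j}|\Psi_{kj}|=o(1)$ as $n\to\infty$. Let $R=R^{(n)}$ be the local randomizer, that is, a random diagonal $N_n\times N_n$ matrix whose diagonal entries are i.i.d. with $P(R_{kk}=1)=P(R_{kk}=-1)=1/2$. Put $A=FR$, let $S_{ij}=(A\Psi)_{ij}$ be the entries of $A\Psi$ and let $\sigma_{ij}^2=\operatorname{Var}(S_{ij})$. Then the entries of $A\Psi$ are asymptotically normally distributed $\mathcal N(0,\sigma_{ij}^2)$: for every $x\in\mathbb R$, $$P\Big(\frac{S_{ij}}{\sigma_{ij}}\le x\Big)\longrightarrow \frac1{\sqrt{2\pi}}\int_{-\infty}^x e^{-y^2/2}\,dy\qquad (n\to\infty),$$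 uniformly over all $i,j\in\{1,\dots,N_n\}$. Moreover $\sigma_{ij}^2$ is of order $1/N_n$: for all sufficiently large $n$ and all $i,j$, $$\frac{c_1^2}{N_n}\le\sigma_{ij}^2\le\frac{c_2^2}{N_n}.$$ -/

import Mathlib

open MeasureTheory ProbabilityTheory Filter Topology

/-- `R` is a local randomizer: a random diagonal matrix whose diagonal entries are i.i.d. and
take the values `1` and `-1` with probability `1/2` each. -/
structure IsLocalRandomizer {Ω ι : Type*} [MeasurableSpace Ω] (P : Measure Ω)
    (R : Ω → Matrix ι ι ℝ) : Prop where
  isDiag : ∀ ω, (R ω).IsDiag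
  measurable_diag : ∀ k, Measurable fun ω => R ω k k
  indep : iIndepFun (fun k ω => R ω k k) P
  prob_one : ∀ k, P {ω | R ω k k = 1} = 1 / 2
  prob_neg_one : ∀ k, P {ω | R ω k k = -1} = 1 / 2

/-- Every row has Euclidean norm `1`. -/
def UnitNormRows {m n : Type*} [Fintype n] (A : Matrix m n ℝ) : Prop :=
  ∀ i, ∑ k, A i k ^ 2 = 1

/-- Every column has Euclidean norm `1`. -/
def UnitNormColumns {m n : Type*} [Fintype m] (A : Matrix m n ℝ) : Prop :=
  ∀ j, ∑ k, A k j ^ 2 = 1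

/-- The maximal absolute value of the entries of a finite matrix (`0` for an empty matrix). -/
noncomputable def maxAbsEntry {m n : Type*} (A : Matrix m n ℝ) : ℝ :=
  ⨆ p : m × n, |A p.1 p.2|

/-- The random variables `X n a` (`a` ranging over an index set `ι n` that may grow with `n`) are
asymptotically normally distributed `N(0, σ n a ^ 2)`: for every real `x`,
`P (X n a / σ n a ≤ x)` tends, as `n → ∞` and uniformly in `a`, to the value at `x` of the
distribution function of the standard normal law. When each `ι n` has exactly one element, this is
the usual notion for a sequence of random variables. -/
def AsymptoticallyNormal {Ω ι : ℕ → Type*} [∀ n, MeasurableSpace (Ω n)]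
    (P : ∀ n, Measure (Ω n)) (X : ∀ n, ι n → Ω n → ℝ) (σ : ∀ n, ι n → ℝ) : Prop :=
  ∀ x : ℝ, ∀ ε > 0, ∀ᶠ n in atTop, ∀ a : ι n,
    |(P n).real {ω | X n a ω / σ n a ≤ x} - cdf (gaussianReal 0 1) x| < ε

/-! Each entry of `F R Ψ` is a sum of independent signs with weights `F i k * Ψ k j`, so its
variance is the sum of the squared weights. Since `F` is flat and the columns of `Ψ` are unit
vectors, this lies between `c₁² / N` and `c₂² / N`. A single squared weight is at most `(c₂² / N) *
max |Ψ|²`, hence negligible against the variance, uniformly in `i, j`: Lindeberg's condition. After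
normalization the characteristic function at `t` is a product of cosines whose arguments have
squares adding up to `t²`. If all arguments are small, it is close to `exp (-t² / 2)`, with an
explicit error (`abs_prod_cos_sub_exp_le`). Lévy's continuity theorem concludes; uniformity comes
from applying it along a sequence of worst indices. -/

/-- Pointwise convergence of characteristic functions, uniform over an index set that may depend
on `n`, implies convergence of the distribution functions with the same uniformity. -/
lemma eventually_forall_abs_cdf_sub_lt {ι : ℕ → Type*} (ν : ∀ n, ι n → ProbabilityMeasure ℝ)
    (μ : ProbabilityMeasure ℝ) (hμ : ∀ x, (μ : Measure ℝ) {x} = 0)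
    (h : ∀ t : ℝ, ∀ ε > 0, ∀ᶠ n in atTop, ∀ a,
      ‖charFun (ν n a : Measure ℝ) t - charFun (μ : Measure ℝ) t‖ < ε)
    (x : ℝ) {ε : ℝ} (hε : 0 < ε) :
    ∀ᶠ n in atTop, ∀ a, |cdf (ν n a : Measure ℝ) x - cdf (μ : Measure ℝ) x| < ε := by
  classical
  let bad n a := ε ≤ |cdf (ν n a : Measure ℝ) x - cdf (μ : Measure ℝ) x|
  -- Select a violating index whenever one exists, and the limit law otherwise; convergence of this
  -- one sequence rules out violations for large `n`.
  let ρ : ℕ → ProbabilityMeasure ℝ := fun n =>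
    if hn : ∃ a, bad n a then ν n hn.choose else μ
  have hρ : Tendsto ρ atTop (𝓝 μ) := by
    refine ProbabilityMeasure.tendsto_of_tendsto_charFun fun t => ?_
    rw [Metric.tendsto_atTop']
    intro δ hδ
    obtain ⟨n₀, hn₀⟩ := eventually_atTop.1 (h t δ hδ)
    refine ⟨n₀, fun n hn => ?_⟩
    rw [dist_eq_norm]
    by_cases hb : ∃ a, bad n a
    · simpa only [ρ, dif_pos hb] using hn₀ n hn.le _
    · simpa only [ρ, dif_neg hb, sub_self, norm_zero] using hδ
  have hcdf : Tendsto (fun n => cdf (ρ n : Measure ℝ) x) atTop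
      (𝓝 (cdf (μ : Measure ℝ) x)) := by
    simp_rw [cdf_eq_real]
    have := ProbabilityMeasure.tendsto_measure_of_null_frontier_of_tendsto' hρ
      (E := Set.Iic x) (by rw [frontier_Iic]; exact hμ x)
    exact (ENNReal.tendsto_toReal (measure_ne_top _ _)).comp this
  filter_upwards [Metric.tendsto_nhds.1 hcdf ε hε] with n hn
  by_contra! hb
  replace hb : ∃ a, bad n a := hb
  have hbad : bad n hb.choose := hb.choose_spec
  rw [Real.dist_eq] at hn
  simp only [ρ, dif_pos hb] at hn
  exact absurd hn (not_lt.2 hbad)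

/-- Both functions are `1 - u² / 2` up to `O(u⁴)` near `0`; for `|u| ≥ 1` the difference is at most
`2`. -/
lemma abs_cos_sub_exp_le (u : ℝ) : |Real.cos u - Real.exp (-(u ^ 2 / 2))| ≤ 2 * u ^ 4 := by
  have h4 : |u| ^ 4 = u ^ 4 := by rw [← abs_pow, abs_of_nonneg (by positivity)]
  rcases le_total |u| 1 with hu | hu
  · have h2 : u ^ 2 ≤ 1 := (sq_le_one_iff_abs_le_one u).2 hu
    have hc := Real.cos_bound hu
    have he := Real.abs_exp_sub_one_sub_id_le (x := -(u ^ 2 / 2))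
      (by rw [abs_neg, abs_of_nonneg (by positivity)]; linarith)
    rw [h4] at hc
    rw [abs_le] at *
    have : 0 ≤ u ^ 4 := by positivity
    constructor <;> nlinarith
  · have h1 : 1 ≤ u ^ 4 := by rw [← h4]; exact one_le_pow₀ hu
    have := Real.abs_cos_le_one u
    have he : Real.exp (-(u ^ 2 / 2)) ≤ 1 := Real.exp_le_one_iff.2 (by nlinarith [sq_nonneg u])
    have := Real.exp_pos (-(u ^ 2 / 2))
    rw [abs_le] at *
    constructor <;> linarith

/-- Exchange one factor at a time; the remaining factors have absolute value at most `1`. -/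
lemma abs_prod_sub_prod_le {ι : Type*} (s : Finset ι) (f g : ι → ℝ)
    (hf : ∀ i, |f i| ≤ 1) (hg : ∀ i, |g i| ≤ 1) :
    |∏ i ∈ s, f i - ∏ i ∈ s, g i| ≤ ∑ i ∈ s, |f i - g i| := by
  classical
  induction s using Finset.induction_on with
  | empty => simp
  | insert a s ha ih =>
    rw [Finset.prod_insert ha, Finset.prod_insert ha, Finset.sum_insert ha]
    have hp : |∏ i ∈ s, f i| ≤ 1 := by
      rw [Finset.abs_prod]
      exact Finset.prod_le_one (fun _ _ => abs_nonneg _) fun i _ => hf i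
    calc |f a * ∏ i ∈ s, f i - g a * ∏ i ∈ s, g i|
        = |(f a - g a) * ∏ i ∈ s, f i + g a * (∏ i ∈ s, f i - ∏ i ∈ s, g i)| := by ring_nf
      _ ≤ |f a - g a| * |∏ i ∈ s, f i| + |g a| * |∏ i ∈ s, f i - ∏ i ∈ s, g i| := by
        rw [← abs_mul, ← abs_mul]; exact abs_add_le _ _
      _ ≤ |f a - g a| * 1 + 1 * ∑ i ∈ s, |f i - g i| := by
        gcongr
        exact hg a
      _ = _ := by ring

/-- If the squares of the `u i` add up to `v`, then `∏ cos (u i)` is close to `exp (-v / 2)` as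
soon as all `u i` are small. -/
lemma abs_prod_cos_sub_exp_le {ι : Type*} (s : Finset ι) (u : ι → ℝ) {δ v : ℝ}
    (hv : ∑ i ∈ s, u i ^ 2 = v) (hδ : ∀ i, u i ^ 2 ≤ δ) :
    |∏ i ∈ s, Real.cos (u i) - Real.exp (-(v / 2))| ≤ 2 * δ * v := by
  have he : Real.exp (-(v / 2)) = ∏ i ∈ s, Real.exp (-(u i ^ 2 / 2)) := by
    rw [← Real.exp_sum, Finset.sum_neg_distrib, ← Finset.sum_div, hv]
  rw [he]
  refine (abs_prod_sub_prod_le s _ _ (fun i => Real.abs_cos_le_one _) fun i => ?_).trans ?_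
  · rw [Real.abs_exp, Real.exp_le_one_iff]
    nlinarith [sq_nonneg (u i)]
  · rw [← hv, Finset.mul_sum]
    refine Finset.sum_le_sum fun i _ => (abs_cos_sub_exp_le _).trans ?_
    nlinarith [mul_le_mul_of_nonneg_right (hδ i) (sq_nonneg (u i))]

/-! ### Random signs -/

section Rademacher

variable {Ω : Type*} [MeasurableSpace Ω] {P : Measure Ω} [IsProbabilityMeasure P] {X : Ω → ℝ}

lemma ae_eq_one_or_eq_neg_one (hX : Measurable X) (h₁ : P {ω | X ω = 1} = 1 / 2)
    (h₂ : P {ω | X ω = -1} = 1 / 2) : ∀ᵐ ω ∂P, X ω = 1 ∨ X ω = -1 := by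
  have hm : MeasurableSet {ω | X ω = -1} := hX (measurableSet_singleton (-1))
  have hm' : MeasurableSet {ω | X ω = 1} := hX (measurableSet_singleton 1)
  have hd : Disjoint {ω | X ω = 1} {ω | X ω = -1} := by
    rw [Set.disjoint_left]
    intro ω (h : X ω = 1) (h' : X ω = -1)
    linarith
  have hu : P ({ω | X ω = 1} ∪ {ω | X ω = -1}) = 1 := by
    rw [measure_union hd hm, h₁, h₂, ENNReal.add_halves]
  exact (mem_ae_iff_prob_eq_one (hm'.union hm)).2 hu

lemma integral_comp_of_prob_eq_half {E : Type*} [NormedAddCommGroup E] [NormedSpace ℝ E]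
    [CompleteSpace E] (hX : Measurable X) (h₁ : P {ω | X ω = 1} = 1 / 2)
    (h₂ : P {ω | X ω = -1} = 1 / 2) (f : ℝ → E) :
    ∫ ω, f (X ω) ∂P = (1 / 2 : ℝ) • f 1 + (1 / 2 : ℝ) • f (-1) := by
  have hm : MeasurableSet {ω | X ω = -1} := hX (measurableSet_singleton (-1))
  have hm' : MeasurableSet {ω | X ω = 1} := hX (measurableSet_singleton 1)
  have hae : (fun ω => f (X ω)) =ᵐ[P] fun ω =>
      {ω | X ω = 1}.indicator (fun _ => f 1) ω + {ω | X ω = -1}.indicator (fun _ => f (-1)) ω := by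
    filter_upwards [ae_eq_one_or_eq_neg_one hX h₁ h₂] with ω hω
    rcases hω with h | h <;> simp [Set.indicator, h] <;> norm_num
  rw [integral_congr_ae hae, integral_add ((integrable_const _).indicator hm')
    ((integrable_const _).indicator hm), integral_indicator_const _ hm',
    integral_indicator_const _ hm, measureReal_def, measureReal_def, h₁, h₂]
  simp

lemma charFun_map_const_mul_of_prob_eq_half (hX : Measurable X) (h₁ : P {ω | X ω = 1} = 1 / 2)
    (h₂ : P {ω | X ω = -1} = 1 / 2) (b t : ℝ) :
    charFun (P.map fun ω => b * X ω) t = (Real.cos (b * t) : ℂ) := by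
  rw [charFun_map_mul_comp hX.aemeasurable, charFun_apply_real,
    integral_map hX.aemeasurable (by fun_prop),
    integral_comp_of_prob_eq_half hX h₁ h₂ (fun x => Complex.exp (((b * t : ℝ) : ℂ) * x * Complex.I)),
    Complex.ofReal_cos, Complex.cos]
  simp only [Complex.real_smul]
  push_cast
  ring_nf

lemma memLp_of_prob_eq_half (hX : Measurable X) (h₁ : P {ω | X ω = 1} = 1 / 2)
    (h₂ : P {ω | X ω = -1} = 1 / 2) : MemLp X 2 P := by
  refine MemLp.of_bound hX.aestronglyMeasurable 1 ?_
  filter_upwards [ae_eq_one_or_eq_neg_one hX h₁ h₂] with ω hω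
  rcases hω with h | h <;> simp [h]

lemma variance_of_prob_eq_half (hX : Measurable X) (h₁ : P {ω | X ω = 1} = 1 / 2)
    (h₂ : P {ω | X ω = -1} = 1 / 2) : Var[X; P] = 1 := by
  have h0 : ∫ ω, X ω ∂P = 0 := by
    rw [integral_comp_of_prob_eq_half hX h₁ h₂ (fun x => x)]; norm_num
  rw [variance_eq_integral hX.aemeasurable, h0,
    integral_comp_of_prob_eq_half hX h₁ h₂ (fun x => (x - 0) ^ 2)]
  norm_num

end Rademacher

/-! ### Weighted sums of independent signs -/

namespace IsLocalRandomizer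

variable {Ω ι : Type*} [MeasurableSpace Ω] [Fintype ι] {P : Measure Ω} {R : Ω → Matrix ι ι ℝ}

lemma mul_mul_apply {m n : Type*} (hR : IsLocalRandomizer P R)
    (F : Matrix m ι ℝ) (Ψ : Matrix ι n ℝ) (i : m) (j : n) (ω : Ω) :
    (F * R ω * Ψ) i j = ∑ k, F i k * Ψ k j * R ω k k := by
  classical
  rw [← (hR.isDiag ω).diagonal_diag, Matrix.mul_apply]
  refine Finset.sum_congr rfl fun k _ => ?_
  rw [Matrix.mul_diagonal]
  simp only [Matrix.diag_apply, Matrix.diagonal_apply_eq]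
  ring

lemma variance_sum_mul [IsProbabilityMeasure P] (hR : IsLocalRandomizer P R) (b : ι → ℝ) :
    Var[fun ω => ∑ k, b k * R ω k k; P] = ∑ k, b k ^ 2 := by
  have hsum : (fun ω => ∑ k, b k * R ω k k) = ∑ k, fun ω => b k * R ω k k := by
    ext ω; simp
  rw [hsum, IndepFun.variance_sum]
  · refine Finset.sum_congr rfl fun k _ => ?_
    rw [variance_const_mul,
      variance_of_prob_eq_half (hR.measurable_diag k) (hR.prob_one k) (hR.prob_neg_one k), mul_one]
  · exact fun k _ => (memLp_of_prob_eq_half (hR.measurable_diag k) (hR.prob_one k)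
      (hR.prob_neg_one k)).const_mul (b k)
  · exact fun k _ l _ hkl => (hR.indep.indepFun hkl).comp (φ := fun x => b k * x)
      (ψ := fun x => b l * x) (by fun_prop) (by fun_prop)

lemma charFun_sum_mul [IsProbabilityMeasure P] (hR : IsLocalRandomizer P R) (b : ι → ℝ) (t : ℝ) :
    charFun (P.map fun ω => ∑ k, b k * R ω k k) t = ((∏ k, Real.cos (b k * t) : ℝ) : ℂ) := by
  have hind : iIndepFun (fun k ω => b k * R ω k k) P :=
    hR.indep.comp (fun k x => b k * x) fun k => by fun_prop
  rw [hind.charFun_map_fun_sum_eq_prod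
    fun k => ((hR.measurable_diag k).const_mul (b k)).aemeasurable, Finset.prod_apply]
  push_cast
  refine Finset.prod_congr rfl fun k _ => ?_
  rw [charFun_map_const_mul_of_prob_eq_half (hR.measurable_diag k) (hR.prob_one k)
    (hR.prob_neg_one k)]
  push_cast
  rfl

end IsLocalRandomizer

/-- **Lindeberg's theorem for weighted sums of signs**, uniform over an index set that may depend
on `n`: it suffices that every squared weight is eventually small against their sum. -/
lemma asymptoticallyNormal_sum_mul {Ω ι κ : ℕ → Type*} [∀ n, MeasurableSpace (Ω n)]
    [∀ n, Fintype (κ n)] (P : ∀ n, Measure (Ω n)) [∀ n, IsProbabilityMeasure (P n)]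
    (R : ∀ n, Ω n → Matrix (κ n) (κ n) ℝ) (hR : ∀ n, IsLocalRandomizer (P n) (R n))
    (b : ∀ n, ι n → κ n → ℝ) (hpos : ∀ᶠ n in atTop, ∀ a, 0 < ∑ k, b n a k ^ 2)
    (hb : ∀ δ > 0, ∀ᶠ n in atTop, ∀ a k, b n a k ^ 2 ≤ δ * ∑ l, b n a l ^ 2) :
    AsymptoticallyNormal P (fun n a ω => ∑ k, b n a k * R n ω k k)
      (fun n a => √(∑ k, b n a k ^ 2)) := by
  intro x ε hε
  let c n a k := b n a k / √(∑ l, b n a l ^ 2)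
  let Y n a (ω : Ω n) := ∑ k, c n a k * R n ω k k
  have hY n a : Measurable (Y n a) :=
    Finset.measurable_fun_sum _ fun k _ => ((hR n).measurable_diag k).const_mul _
  let ν n (a : ι n) : ProbabilityMeasure ℝ :=
    ⟨(P n).map (Y n a), Measure.isProbabilityMeasure_map (hY n a).aemeasurable⟩
  let γ : ProbabilityMeasure ℝ := ⟨gaussianReal 0 1, inferInstance⟩
  have hγ (x : ℝ) : (γ : Measure ℝ) {x} = 0 := by
    have := nullSingletonClass_gaussianReal (μ := 0) (v := 1) one_ne_zero
    exact measure_singleton (μ := gaussianReal 0 1) x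
  have key : ∀ t : ℝ, ∀ ε > 0, ∀ᶠ n in atTop, ∀ a,
      ‖charFun (ν n a : Measure ℝ) t - charFun (γ : Measure ℝ) t‖ < ε := by
    intro t ε hε
    -- The product estimate will give the error `2 t⁴` times this tolerance, which is below `ε`; the
    -- `+ 1` covers `t = 0`.
    filter_upwards [hpos, hb (ε / (2 * t ^ 4 + 1)) (by positivity)] with n hn hbn a
    have hs : √(∑ l, b n a l ^ 2) ^ 2 = ∑ l, b n a l ^ 2 := Real.sq_sqrt (hn a).le
    have hsq k : (c n a k * t) ^ 2 = b n a k ^ 2 / (∑ l, b n a l ^ 2) * t ^ 2 := by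
      rw [mul_pow, div_pow, hs]
    have hsum : ∑ k, (c n a k * t) ^ 2 = t ^ 2 := by
      simp_rw [hsq]
      rw [← Finset.sum_mul, ← Finset.sum_div, div_self (hn a).ne', one_mul]
    have hle k : (c n a k * t) ^ 2 ≤ ε / (2 * t ^ 4 + 1) * t ^ 2 := by
      rw [hsq]
      exact mul_le_mul_of_nonneg_right ((div_le_iff₀ (hn a)).2 (hbn a k)) (sq_nonneg t)
    have h := abs_prod_cos_sub_exp_le Finset.univ (fun k => c n a k * t) hsum hle
    have hg : charFun (γ : Measure ℝ) t = (Real.exp (-(t ^ 2 / 2)) : ℂ) := by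
      change charFun (gaussianReal 0 1) t = _
      rw [charFun_gaussianReal]
      push_cast
      simp
    have hν : charFun (ν n a : Measure ℝ) t = ((∏ k, Real.cos (c n a k * t) : ℝ) : ℂ) :=
      (hR n).charFun_sum_mul (c n a) t
    rw [hν, hg, ← Complex.ofReal_sub, Complex.norm_real, Real.norm_eq_abs]
    refine h.trans_lt ?_
    have : 2 * (ε / (2 * t ^ 4 + 1) * t ^ 2) * t ^ 2 = ε * ((2 * t ^ 4) / (2 * t ^ 4 + 1)) := by
      ring
    rw [this]
    refine mul_lt_of_lt_one_right hε ((div_lt_one (by positivity)).2 (by linarith))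
  filter_upwards [eventually_forall_abs_cdf_sub_lt ν γ hγ key x hε] with n hn a
  have hcdf : cdf (ν n a : Measure ℝ) x =
      (P n).real {ω | (∑ k, b n a k * R n ω k k) / √(∑ k, b n a k ^ 2) ≤ x} := by
    rw [cdf_eq_real]
    change ((P n).map (Y n a)).real (Set.Iic x) = _
    rw [map_measureReal_apply (hY n a) measurableSet_Iic]
    congr 1
    ext ω
    simp only [Set.mem_ofPred_eq, Set.mem_preimage, Set.mem_Iic, Y, c, Finset.sum_div, div_mul_eq_mul_div]
  rw [← hcdf]
  exact hn a

/-! ### Flat matrices and the main theorem -/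

lemma abs_le_maxAbsEntry {m n : Type*} [Finite m] [Finite n] (A : Matrix m n ℝ) (i : m) (j : n) :
    |A i j| ≤ maxAbsEntry A :=
  le_ciSup (f := fun p : m × n => |A p.1 p.2|) (Set.finite_range _).bddAbove (i, j)

/-- A column of norm one, weighted by entries between `l` and `u` in absolute value, has squared
norm between `l ^ 2` and `u ^ 2`. -/
lemma sum_mul_sq_mem_Icc {κ : Type*} [Fintype κ] {f ψ : κ → ℝ} {l u : ℝ} (hl : 0 ≤ l)
    (hf : ∀ k, l ≤ |f k| ∧ |f k| ≤ u) (hψ : ∑ k, ψ k ^ 2 = 1) :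
    ∑ k, (f k * ψ k) ^ 2 ∈ Set.Icc (l ^ 2) (u ^ 2) := by
  have hsq k : l ^ 2 ≤ f k ^ 2 ∧ f k ^ 2 ≤ u ^ 2 := by
    rw [← sq_abs (f k)]
    exact ⟨pow_le_pow_left₀ hl (hf k).1 2, pow_le_pow_left₀ (abs_nonneg _) (hf k).2 2⟩
  constructor
  · calc l ^ 2 = ∑ k, l ^ 2 * ψ k ^ 2 := by rw [← Finset.mul_sum, hψ, mul_one]
      _ ≤ _ := Finset.sum_le_sum fun k _ => by
        rw [mul_pow]; exact mul_le_mul_of_nonneg_right (hsq k).1 (sq_nonneg _)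
  · calc ∑ k, (f k * ψ k) ^ 2 ≤ ∑ k, u ^ 2 * ψ k ^ 2 := Finset.sum_le_sum fun k _ => by
          rw [mul_pow]; exact mul_le_mul_of_nonneg_right (hsq k).2 (sq_nonneg _)
      _ = u ^ 2 := by rw [← Finset.mul_sum, hψ, mul_one]

theorem theorem1 {Ω : ℕ → Type*} [∀ n, MeasurableSpace (Ω n)]
    (P : ∀ n, Measure (Ω n)) [∀ n, IsProbabilityMeasure (P n)]
    (N : ℕ → ℕ) (hN : Tendsto N atTop atTop)
    (F Ψ : ∀ n, Matrix (Fin (N n)) (Fin (N n)) ℝ)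
    (R : ∀ n, Ω n → Matrix (Fin (N n)) (Fin (N n)) ℝ)
    (hR : ∀ n, IsLocalRandomizer (P n) (R n))
    (hF : ∀ n, UnitNormRows (F n))
    (c₁ c₂ : ℝ) (hc₁ : 0 < c₁)
    (hFentries : ∀ᶠ n in atTop, ∀ i k,
      c₁ / √(N n : ℝ) ≤ |F n i k| ∧ |F n i k| ≤ c₂ / √(N n : ℝ))
    (hΨ : ∀ n, UnitNormColumns (Ψ n))
    (hΨentries : (fun n => maxAbsEntry (Ψ n)) =o[atTop] (fun _ => (1 : ℝ))) :
    AsymptoticallyNormal P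
      (fun n (p : Fin (N n) × Fin (N n)) ω => (F n * R n ω * Ψ n) p.1 p.2)
      (fun n p => √(Var[fun ω => (F n * R n ω * Ψ n) p.1 p.2; P n])) ∧
    ∀ᶠ n in atTop, ∀ i j,
      c₁ ^ 2 / (N n : ℝ) ≤ Var[fun ω => (F n * R n ω * Ψ n) i j; P n] ∧
      Var[fun ω => (F n * R n ω * Ψ n) i j; P n] ≤ c₂ ^ 2 / (N n : ℝ) := by

  have hmul n i j : (fun ω => (F n * R n ω * Ψ n) i j) =
      fun ω => ∑ k, F n i k * Ψ n k j * R n ω k k :=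
    funext fun ω => (hR n).mul_mul_apply (F n) (Ψ n) i j ω
  have hvar n i j : Var[fun ω => (F n * R n ω * Ψ n) i j; P n] = ∑ k, (F n i k * Ψ n k j) ^ 2 := by
    rw [hmul, (hR n).variance_sum_mul fun k => F n i k * Ψ n k j]
  have hbounds : ∀ᶠ n in atTop, 0 < (N n : ℝ) ∧ ∀ i j,
      ∑ k, (F n i k * Ψ n k j) ^ 2 ∈ Set.Icc (c₁ ^ 2 / (N n : ℝ)) (c₂ ^ 2 / (N n : ℝ)) := by
    filter_upwards [hFentries, hN.eventually_gt_atTop 0] with n hn hpos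
    refine ⟨by exact_mod_cast hpos, fun i j => ?_⟩
    have := sum_mul_sq_mem_Icc (by positivity) (hn i) (hΨ n j)
    rwa [div_pow, div_pow, Real.sq_sqrt (Nat.cast_nonneg _)] at this
  constructor
  · suffices h : AsymptoticallyNormal P
        (fun n (p : Fin (N n) × Fin (N n)) ω => ∑ k, F n p.1 k * Ψ n k p.2 * R n ω k k)
        (fun n p => √(∑ k, (F n p.1 k * Ψ n k p.2) ^ 2)) by
      intro x ε hε
      filter_upwards [h x ε hε] with n hn p
      rw [hvar]
      simpa only [(hR n).mul_mul_apply] using hn p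
    refine asymptoticallyNormal_sum_mul P R hR
      (fun n (p : Fin (N n) × Fin (N n)) k => F n p.1 k * Ψ n k p.2) ?_ ?_
    · filter_upwards [hbounds] with n hn p
      have := hn.1
      exact lt_of_lt_of_le (by positivity) (hn.2 p.1 p.2).1
    · intro δ hδ
      -- If `|Ψ k j|` is at most this root, then `(c₂² / N) * Ψ k j ^ 2` is at most `δ * c₁² / N`,
      -- i.e. `δ` times the lower variance bound. The `+ 1` keeps the denominator positive whatever
      -- `c₂` is.
      have hη : 0 < √(δ * c₁ ^ 2 / (c₂ ^ 2 + 1)) := by positivity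
      filter_upwards [hbounds, hFentries, hΨentries.def hη] with n hn hF' hM p k
      have hNpos := hn.1
      have hΨk : Ψ n k p.2 ^ 2 ≤ δ * c₁ ^ 2 / (c₂ ^ 2 + 1) := by
        rw [← Real.sq_sqrt (show 0 ≤ δ * c₁ ^ 2 / (c₂ ^ 2 + 1) by positivity), sq_le_sq,
          abs_of_pos hη]
        rw [norm_one, mul_one] at hM
        exact (abs_le_maxAbsEntry _ _ _).trans ((le_abs_self _).trans hM)
      have hFk : F n p.1 k ^ 2 ≤ c₂ ^ 2 / N n := by
        have := pow_le_pow_left₀ (abs_nonneg _) (hF' p.1 k).2 2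
        rwa [sq_abs, div_pow, Real.sq_sqrt hNpos.le] at this
      calc (F n p.1 k * Ψ n k p.2) ^ 2 = F n p.1 k ^ 2 * Ψ n k p.2 ^ 2 := mul_pow _ _ _
        _ ≤ c₂ ^ 2 / N n * (δ * c₁ ^ 2 / (c₂ ^ 2 + 1)) := by gcongr
        _ = δ * (c₁ ^ 2 / N n) * (c₂ ^ 2 / (c₂ ^ 2 + 1)) := by ring
        _ ≤ δ * (c₁ ^ 2 / N n) * 1 := by
          gcongr
          exact (div_le_one (by positivity)).2 (by linarith)
        _ ≤ δ * ∑ l, (F n p.1 l * Ψ n l p.2) ^ 2 := by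
          rw [mul_one]
          exact mul_le_mul_of_nonneg_left (hn.2 p.1 p.2).1 hδ.le
  · filter_upwards [hbounds] with n hn i j
    rw [hvar]
    exact hn.2 i j
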